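/- Let $p$ be a prime; all groups are finite. For a fusion system $\mathcal F$ on a $p$-group $S$, a subgroup $Q\le S$ is *strongly $\mathcal F$-closed* if $x\phi\in Q$ for all $x\in Q$ and $\phi\in\mathrm{Hom}_{\mathcal F}(\langle x\rangle,S)$, and $Q\unlhd\mathcal F$ means $\mathcal F=N_{\mathcal F}(Q)$, i.e. $Q\unlhd S$ and every $\phi\in \mathrm{Hom}_{\mathcal F}(R,T)$ extends to some $\bar\phi\in\mathrm{Hom}_{\mathcal F}(QR,QT)$ with $Q\bar\phi=Q$. A fusion system $\mathcal F$ on $S$ is *saturated* if $\mathrm{Aut}_S(S)$ is a Sylow $p$-subgroup of $\mathrm{Aut}_{\mathcal F}(S)$ and every $\phi\in\mathrm{Hom}_{\mathcal F}(Q,S)$ such that $Q\phi$ is fully normalized extends to a morphism in $\mathrm{Hom}_{\mathcal F}(N_\phi,S)$, where $$N_\phi=\{x\in N_S(Q)\mid \exists\, y\in N_S(Q\phi):\ \phi^{-1}c_x\phi=c_y \text{ on } Q\phi\}.$$ A fusion system $\mathcal E$ on a $p$-group $P$ is *semisaturated, induced by $(\mathcal F,S)$*, if $S$ is a $p$-group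 containing $P$, $\mathcal F$ is a saturated fusion system on $S$, $P$ is strongly $\mathcal F$-closed, and $\mathcal E=\mathcal F|_{\le P}$ consists of all $\mathcal F$-morphisms between subgroups of $P$. A $p$-group $P$ is *strongly resistant in saturated fusion systems* if $P\unlhd\mathcal F$ for every $p$-group $S\ge P$ and every saturated fusion system $\mathcal F$ on $S$ for which $P$ is strongly $\mathcal F$-closed. It is *resistant in semisaturated fusion systems* if $P\unlhd\mathcal E$ for every semisaturated fusion system $\mathcal E$ on $P$. **Corollary.** A $p$-group $P$ is strongly resistant in saturated fusion systems if and only if it is resistant in semisaturated fusion systems. Moreover, if $\mathcal E$ is a semisaturated fusion system on a $p$-group $P$ induced by $(\mathcal F,S)$ and $Q\le P$, then $Q\unlhd\mathcal E$ if and only if $Q\unlhd\mathcal F$. -/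

import Mathlib

universe u v

/-- The image `Qφ` of a homomorphism `φ : Q → R` between subgroups of `S`, as a subgroup of `S`. -/
def homImage {S : Type u} [Group S] {Q R : Subgroup S} (φ : Q →* R) : Subgroup S :=
  (R.subtype.comp φ).range

/-- A fusion system on a (finite `p`-)group `S`: a category whose objects are the subgroups of `S`,
whose morphisms are injective group homomorphisms, which contains all maps induced by conjugation
in `S`, and in which every morphism is an isomorphism of the category onto its image, followed by
an inclusion. -/
@[ext]
structure FusionSystem (S : Type u) [Group S] where
  /-- `Hom_F(Q, R)` -/
  Hom : (Q R : Subgroup S) → Set (Q →* R)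
  injective : ∀ {Q R : Subgroup S} {φ : Q →* R}, φ ∈ Hom Q R → Function.Injective φ
  /-- every map `Q → R` induced by conjugation with an element of `S` is a morphism;
  in particular identities and inclusions are -/
  conj_mem : ∀ {Q R : Subgroup S} (g : S) (φ : Q →* R),
    (∀ x : Q, (φ x : S) = g * (x : S) * g⁻¹) → φ ∈ Hom Q R
  comp_mem : ∀ {Q R T : Subgroup S} {φ : Q →* R} {ψ : R →* T},
    φ ∈ Hom Q R → ψ ∈ Hom R T → ψ.comp φ ∈ Hom Q T
  /-- the isomorphism `ψ : Q → Qφ` induced by a morphism `φ`, and its inverse, are morphisms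
  (the subgroup `R'` below is forced to be the image of `φ`) -/
  iso_mem : ∀ {Q R R' : Subgroup S} {φ : Q →* R} (ψ : Q ≃* R'), φ ∈ Hom Q R →
    (∀ x : Q, (ψ x : S) = (φ x : S)) →
      ψ.toMonoidHom ∈ Hom Q R' ∧ ψ.symm.toMonoidHom ∈ Hom R' Q

/-- `Aut_S(Q)`: the automorphisms of `Q` induced by conjugation with elements of `N_S(Q)`. -/
def conjAut {S : Type u} [Group S] (Q : Subgroup S) : Subgroup (MulAut Q) where
  carrier := {α | ∃ g ∈ Subgroup.normalizer (Q : Set S), ∀ x : Q, (α x : S) = g * (x : S) * g⁻¹}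
  one_mem' := ⟨1, one_mem _, fun x => by simp⟩
  mul_mem' := by
    rintro α β ⟨g, hg, hα⟩ ⟨h, hh, hβ⟩
    exact ⟨g * h, mul_mem hg hh, fun x => by rw [MulAut.mul_apply, hα, hβ]; group⟩
  inv_mem' := by
    rintro α ⟨g, hg, hα⟩
    refine ⟨g⁻¹, inv_mem hg, fun x => ?_⟩
    have h := hα (α⁻¹ x)
    rw [MulAut.apply_inv_self] at h
    rw [h]; group

/-- For `φ : Q → R`, the subgroup `N_φ` of all `x ∈ N_S(Q)` such that, for some `y ∈ N_S(Qφ)`,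
the map `φ` carries conjugation by `x` on `Q` to conjugation by `y` on `Qφ`. -/
def extensionControl {S : Type u} [Group S] {Q R : Subgroup S} (φ : Q →* R) : Subgroup S where
  carrier := {x | x ∈ Subgroup.normalizer (Q : Set S) ∧
    ∃ y ∈ Subgroup.normalizer (homImage φ : Set S), ∀ u v : Q, (v : S) = x * (u : S) * x⁻¹ →
      (φ v : S) = y * (φ u : S) * y⁻¹}
  one_mem' := by
    refine ⟨one_mem _, 1, one_mem _, fun u v h => ?_⟩
    have : v = u := Subtype.ext (by simpa using h)
    simp [this]
  mul_mem' := by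
    rintro a b ⟨ha, y, hy, hay⟩ ⟨hb, z, hz, hbz⟩
    refine ⟨mul_mem ha hb, y * z, mul_mem hy hz, fun u v h => ?_⟩
    have hw : b * (u : S) * b⁻¹ ∈ Q := (Subgroup.mem_normalizer_iff.1 hb _).1 u.2
    rw [hay ⟨_, hw⟩ v (by rw [h]; group), hbz u ⟨_, hw⟩ rfl]
    group
  inv_mem' := by
    rintro a ⟨ha, y, hy, hay⟩
    refine ⟨inv_mem ha, y⁻¹, inv_mem hy, fun u v h => ?_⟩
    rw [hay v u (by rw [h]; group)]
    group

namespace FusionSystem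

variable {S : Type u} [Group S]

/-- `Aut_F(Q)`, as a group of automorphisms of `Q`. -/
def aut (F : FusionSystem S) (Q : Subgroup S) : Subgroup (MulAut Q) where
  carrier := {α | MulEquiv.toMonoidHom α ∈ F.Hom Q Q}
  one_mem' := F.conj_mem 1 _ fun x => by simp
  mul_mem' := fun {_ _} hα hβ => F.comp_mem hβ hα
  inv_mem' := fun {α} hα => (F.iso_mem (φ := MulEquiv.toMonoidHom α) α hα fun _ => rfl).2

/-- `R` is an `F`-conjugate of `Q`: there is `φ ∈ Hom_F(Q, R)` with `Qφ = R`. -/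
def IsConj (F : FusionSystem S) (Q R : Subgroup S) : Prop :=
  ∃ φ ∈ F.Hom Q R, homImage φ = R

/-- `Q` is fully normalized: `|N_S(R)| ≤ |N_S(Q)|` for every `F`-conjugate `R` of `Q`. -/
def IsFullyNormalized (F : FusionSystem S) (Q : Subgroup S) : Prop :=
  ∀ R : Subgroup S, F.IsConj Q R →
    Nat.card (Subgroup.normalizer (R : Set S)) ≤ Nat.card (Subgroup.normalizer (Q : Set S))

/-- `Q` is strongly `F`-closed: for each `x ∈ Q`, every morphism `⟨x⟩ → S` maps `x` into `Q`. -/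
def IsStronglyClosed (F : FusionSystem S) (Q : Subgroup S) : Prop :=
  ∀ x ∈ Q, ∀ φ ∈ F.Hom (Subgroup.zpowers x) ⊤,
    (φ ⟨x, Subgroup.mem_zpowers x⟩ : S) ∈ Q

/-- A fusion system on a finite `p`-group `S` is saturated if `Aut_S(S)` is a Sylow `p`-subgroup of
`Aut_F(S)` and every `φ ∈ Hom_F(Q, S)` with fully normalized image extends to a morphism
`N_φ → S`. -/
structure IsSaturated (p : ℕ) (F : FusionSystem S) : Prop where
  sylow : ∃ T : Sylow p (F.aut ⊤), (T : Subgroup (F.aut ⊤)) = (conjAut ⊤).subgroupOf (F.aut ⊤)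
  extend : ∀ (Q : Subgroup S), ∀ φ ∈ F.Hom Q ⊤, F.IsFullyNormalized (homImage φ) →
    ∃ ψ ∈ F.Hom (extensionControl φ) ⊤,
      ∀ (x : Q) (y : extensionControl φ), (y : S) = (x : S) → (ψ y : S) = (φ x : S)

/-- The morphisms `R → T` of `F` that extend to a morphism `QR → QT` of `F` mapping `Q` onto `Q`.
For `R, T ≤ N_S(Q)` these are the morphisms of the normalizer system `N_F(Q)` on `N_S(Q)`, and
then `Q ⊔ R = QR` and `Q ⊔ T = QT`. -/
def normalizerHom (F : FusionSystem S) (Q R T : Subgroup S) : Set (R →* T) :=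
  {φ | φ ∈ F.Hom R T ∧ ∃ ψ ∈ F.Hom (Q ⊔ R) (Q ⊔ T),
    (∀ (x : R) (y : ↥(Q ⊔ R)), (y : S) = (x : S) → (ψ y : S) = (φ x : S)) ∧
    (fun y : ↥(Q ⊔ R) => (ψ y : S)) '' {y | (y : S) ∈ Q} = (Q : Set S)}

/-- `Q ⊴ F`, that is, `F = N_F(Q)`: the two systems live on the same group, `N_S(Q) = S`, and have
the same morphisms. -/
def IsNormal (F : FusionSystem S) (Q : Subgroup S) : Prop :=
  Subgroup.normalizer (Q : Set S) = ⊤ ∧ ∀ R T : Subgroup S, F.Hom R T = F.normalizerHom Q R T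

section restrict

variable {P : Type v} [Group P]

/-- The homomorphism `Qi → Ri` that corresponds to `φ : Q → R` under an embedding `i : P → S`. -/
noncomputable def transport (i : P →* S) (hi : Function.Injective i) {Q R : Subgroup P}
    (φ : Q →* R) : Q.map i →* R.map i :=
  ((R.equivMapOfInjective i hi).toMonoidHom.comp φ).comp
    (Q.equivMapOfInjective i hi).symm.toMonoidHom

theorem transport_apply (i : P →* S) (hi : Function.Injective i) {Q R : Subgroup P}
    (φ : Q →* R) (x : Q) :
    (transport i hi φ (Q.equivMapOfInjective i hi x) : S) = i (φ x) := by
  simp [transport]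

/-- The restriction `F|_{≤ P}` of a fusion system `F` on `S` to a group `P` that is embedded in `S`
by `i`: all morphisms of `F` between subgroups of `P`. -/
noncomputable def restrict (F : FusionSystem S) (i : P →* S) (hi : Function.Injective i) :
    FusionSystem P where
  Hom Q R := {φ | transport i hi φ ∈ F.Hom (Q.map i) (R.map i)}
  injective := by
    intro Q R φ hφ x y hxy
    have h := F.injective hφ (a₁ := Q.equivMapOfInjective i hi x)
      (a₂ := Q.equivMapOfInjective i hi y)
      (Subtype.ext (by rw [transport_apply, transport_apply, hxy]))
    exact (Q.equivMapOfInjective i hi).injective h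
  conj_mem := by
    intro Q R g φ h
    refine F.conj_mem (i g) _ fun x => ?_
    obtain ⟨x, rfl⟩ := (Q.equivMapOfInjective i hi).surjective x
    rw [transport_apply, h]
    simp
  comp_mem := by
    intro Q R T φ ψ hφ hψ
    have h : transport i hi (ψ.comp φ) = (transport i hi ψ).comp (transport i hi φ) := by
      ext x
      simp [transport]
    change transport i hi (ψ.comp φ) ∈ F.Hom _ _
    rw [h]
    exact F.comp_mem hφ hψ
  iso_mem := by
    intro Q R R' φ ψ hφ h
    exact F.iso_mem (((Q.equivMapOfInjective i hi).symm.trans ψ).trans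
      (R'.equivMapOfInjective i hi)) hφ fun x => by
        obtain ⟨x, rfl⟩ := (Q.equivMapOfInjective i hi).surjective x
        rw [transport_apply]
        simp [h]

end restrict

/-- The fusion system `E` on `P` is semisaturated and induced by `(F, S)`, where `P` is regarded as
a subgroup of `S` by means of `i`. -/
structure IsInducedBy (p : ℕ) {P : Type v} [Group P] (E : FusionSystem P) (F : FusionSystem S)
    (i : P →* S) (hi : Function.Injective i) : Prop where
  saturated : F.IsSaturated p
  stronglyClosed : F.IsStronglyClosed i.range
  eq_restrict : E = F.restrict i hi

/-- A fusion system on a finite `p`-group `P` is semisaturated if it is induced by some saturated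
fusion system on a finite `p`-group containing `P`. -/
def IsSemisaturated (p : ℕ) {P : Type u} [Group P] (E : FusionSystem P) : Prop :=
  ∃ (S : Type u) (_ : Group S) (F : FusionSystem S) (i : P →* S) (hi : Function.Injective i),
    Finite S ∧ IsPGroup p S ∧ E.IsInducedBy p F i hi

end FusionSystem

/-- `P` is strongly resistant in saturated fusion systems: whenever `P` is a strongly `F`-closed
subgroup of a finite `p`-group `S` with a saturated fusion system `F`, then `P ⊴ F`. -/
def IsStronglyResistantInSaturated (p : ℕ) (P : Type u) [Group P] : Prop :=
  ∀ (S : Type u) [Group S] [Finite S], IsPGroup p S →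
    ∀ (F : FusionSystem S) (i : P →* S), Function.Injective i →
      F.IsSaturated p → F.IsStronglyClosed i.range → F.IsNormal i.range

/-- `P` is resistant in semisaturated fusion systems: `P ⊴ E` for every semisaturated fusion system
`E` on `P`. -/
def IsResistantInSemisaturated (p : ℕ) (P : Type u) [Group P] : Prop :=
  ∀ E : FusionSystem P, E.IsSemisaturated p → E.IsNormal ⊤

/-! The equivalence of the two kinds of resistance is the case Q = P of the statement on Q, so
everything rests on `IsInducedBy.isNormal_iff`. Passing from F to E is easy: since P is strongly
closed, an extension to QR with R ≤ P keeps its values in P.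

Conversely, let Q be normal in E. An F-morphism defined on ⟨x⟩ with x ∈ Q has values in P, so it
lies in E and extends to a morphism inducing an automorphism of Q. Hence all characteristic
subgroups of Q are strongly F-closed (`isStronglyClosed_map_of_isNormal_restrict`), in particular
the terms of its upper central series. Together with S they form a chain of strongly closed
subgroups from 1 to S, and Q acts trivially on its factors.

Such a chain forces normality. The F-automorphisms of T that centralize its factors form a normal
p-subgroup of Aut_F(T), which lies in every Sylow p-subgroup. If T is fully normalized, Aut_S(T) is
Sylow (`IsSaturated.exists_sylow_eq_conjAut`), so for f : R → T every automorphism of T that N_Q(R)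
induces through f lies in Aut_S(T). Thus N_f contains N_Q(R), f extends to R N_Q(R), and growth of
normalizers leads up to QR (`IsSaturated.exists_extension_sup`). -/

theorem IsPGroup.exists_mem_normalizer_notMem {p : ℕ} [Fact p.Prime] {G : Type*} [Group G]
    {H K : Subgroup G} [Finite K] (hK : IsPGroup p K) (hHK : H ≤ K) (hne : ¬ K ≤ H) :
    ∃ x ∈ K, x ∉ H ∧ x ∈ Subgroup.normalizer (H : Set G) := by
  have := hK.isNilpotent
  have hlt : H.subgroupOf K < ⊤ :=
    lt_top_iff_ne_top.2 fun h => hne (Subgroup.subgroupOf_eq_top.1 h)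
  obtain ⟨x, hx, hxH⟩ :=
    SetLike.exists_of_lt (Group.normalizerCondition_of_isNilpotent _ hlt)
  refine ⟨x, x.2, fun h => hxH (Subgroup.mem_subgroupOf.2 h), ?_⟩
  rw [Subgroup.mem_normalizer_iff] at hx ⊢
  intro h
  constructor
  · intro hh
    exact (hx ⟨h, hHK hh⟩).1 hh
  · intro hh
    have hhK : h ∈ K := by
      have := K.mul_mem (K.mul_mem (K.inv_mem x.2) (hHK hh)) x.2
      rwa [show (x : G)⁻¹ * (x * h * (x : G)⁻¹) * x = h by group] at this
    exact (hx ⟨h, hhK⟩).2 hh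

theorem Subgroup.mem_of_pow_mem_of_coprime {G : Type*} [Group G] {H : Subgroup G} {x : G}
    {m n : ℕ} (hmn : m.Coprime n) (hm : x ^ m ∈ H) (hn : x ^ n ∈ H) : x ∈ H := by
  have h : x = (x ^ m) ^ m.gcdA n * (x ^ n) ^ m.gcdB n := by
    rw [← zpow_natCast, ← zpow_natCast, ← zpow_mul, ← zpow_mul, ← zpow_add,
      ← Nat.gcd_eq_gcd_ab, hmn.gcd_eq_one]
    simp
  rw [h]
  exact H.mul_mem (H.zpow_mem hm _) (H.zpow_mem hn _)

theorem Subgroup.mem_normalizer_of_conj_mem {G : Type*} [Group G] [Finite G] {H : Subgroup G} {x : G}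
    (h : ∀ y ∈ H, x * y * x⁻¹ ∈ H) : x ∈ Subgroup.normalizer (H : Set G) := by
  rw [Subgroup.mem_normalizer_iff_map_conj_eq]
  refine Subgroup.eq_of_le_of_card_ge ?_ ?_
  · rintro _ ⟨y, hy, rfl⟩
    exact h y hy
  · exact (Nat.card_congr
      (H.equivMapOfInjective _ (MulAut.conj x).injective).toEquiv).le

theorem MulAut.map_pow_apply_of_semiconj {A B : Type*} [Group A] [Group B] {α : MulAut A}
    {β : MulAut B} {e : A → B} (h : ∀ x, β (e x) = e (α x)) (n : ℕ) (x : A) :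
    (β ^ n) (e x) = e ((α ^ n) x) := by
  induction n with
  | zero => simp
  | succ n ih => rw [pow_succ', pow_succ', MulAut.mul_apply, MulAut.mul_apply, ih, h]

namespace FusionSystem

/-! ### Morphisms of a fusion system, handled as functions on `S` -/

section

variable {S : Type u} [Group S] {F : FusionSystem S} {Q R T : Subgroup S} {f g : S → S}

theorem inclusion_mem (F : FusionSystem S) (h : Q ≤ R) : Subgroup.inclusion h ∈ F.Hom Q R :=
  F.conj_mem 1 _ fun x => by simp

/-- A morphism is an isomorphism onto its image followed by an inclusion, so the codomain is
immaterial. This is what makes it safe to record only the values, as `IsMor` does. -/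
theorem codRestrict_mem {R' : Subgroup S} {φ : Q →* R} (hφ : φ ∈ F.Hom Q R) (φ' : Q →* R')
    (h : ∀ x, (φ' x : S) = φ x) : φ' ∈ F.Hom Q R' := by
  have hinj : Function.Injective (R'.subtype.comp φ') := by
    intro x y hxy
    apply F.injective hφ
    ext
    rw [← h, ← h]
    exact hxy
  have hle : (R'.subtype.comp φ').range ≤ R' := by
    rintro _ ⟨x, rfl⟩
    exact (φ' x).2
  have := F.comp_mem (F.iso_mem (MonoidHom.ofInjective hinj) hφ h).1
    (F.inclusion_mem hle)
  convert this using 1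
  ext x
  rfl

/-- The function `f` agrees on `Q` with a morphism `Q → S` of `F`. -/
def IsMor (F : FusionSystem S) (Q : Subgroup S) (f : S → S) : Prop :=
  ∃ φ ∈ F.Hom Q ⊤, ∀ x : Q, (φ x : S) = f x

theorem IsMor.mono (hf : F.IsMor Q f) (h : R ≤ Q) : F.IsMor R f := by
  obtain ⟨φ, hφ, hφf⟩ := hf
  exact ⟨φ.comp (Subgroup.inclusion h), F.comp_mem (F.inclusion_mem h) hφ, fun x => by simp [hφf]⟩

theorem isMor_conj (F : FusionSystem S) (Q : Subgroup S) (a : S) :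
    F.IsMor Q fun x => a * x * a⁻¹ := by
  refine ⟨(Subgroup.topEquiv.symm.toMonoidHom.comp (MulAut.conj a).toMonoidHom).comp Q.subtype,
    F.conj_mem a _ fun x => ?_, fun x => ?_⟩ <;> rfl

theorem isMor_of_hom {φ : Q →* R} (hφ : φ ∈ F.Hom Q R) (hf : ∀ x : Q, f x = φ x) :
    F.IsMor Q f :=
  ⟨(Subgroup.inclusion le_top).comp φ, F.comp_mem hφ (F.inclusion_mem le_top),
    fun x => by simp [hf]⟩

theorem exists_isMor_of_hom {φ : Q →* R} (hφ : φ ∈ F.Hom Q R) :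
    ∃ f, F.IsMor Q f ∧ ∀ x : Q, f x = φ x := by
  classical
  let f : S → S := fun x => if h : x ∈ Q then φ ⟨x, h⟩ else 1
  have h : ∀ x : Q, f x = φ x := fun x => by simp [f]
  exact ⟨f, isMor_of_hom hφ h, h⟩

theorem IsMor.exists_hom (hf : F.IsMor Q f) (h : ∀ x ∈ Q, f x ∈ R) :
    ∃ φ ∈ F.Hom Q R, ∀ x : Q, (φ x : S) = f x := by
  obtain ⟨φ, hφ, hφf⟩ := hf
  refine ⟨((Subgroup.subtype ⊤).comp φ).codRestrict R fun x => ?_, codRestrict_mem hφ _ ?_, ?_⟩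
  · simpa [hφf] using h x x.2
  · intro x; rfl
  · exact hφf

theorem IsMor.map_mul (hf : F.IsMor Q f) {x y : S} (hx : x ∈ Q) (hy : y ∈ Q) :
    f (x * y) = f x * f y := by
  obtain ⟨φ, -, hφf⟩ := hf
  have := congrArg Subtype.val (φ.map_mul ⟨x, hx⟩ ⟨y, hy⟩)
  simpa [hφf] using this

theorem IsMor.map_inv (hf : F.IsMor Q f) {x : S} (hx : x ∈ Q) : f x⁻¹ = (f x)⁻¹ := by
  obtain ⟨φ, -, hφf⟩ := hf
  have : (φ ⟨x, hx⟩⁻¹ : S) = (φ ⟨x, hx⟩ : S)⁻¹ := by rw [_root_.map_inv]; rfl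
  rwa [hφf, hφf] at this

theorem IsMor.map_conj (hf : F.IsMor Q f) {x y : S} (hx : x ∈ Q) (hy : y ∈ Q) :
    f (x * y * x⁻¹) = f x * f y * (f x)⁻¹ := by
  rw [hf.map_mul (Q.mul_mem hx hy) (Q.inv_mem hx), hf.map_mul hx hy, hf.map_inv hx]

theorem IsMor.injOn (hf : F.IsMor Q f) : Set.InjOn f Q := by
  obtain ⟨φ, hφ, hφf⟩ := hf
  intro x hx y hy hxy
  have := F.injective hφ (a₁ := ⟨x, hx⟩) (a₂ := ⟨y, hy⟩) (Subtype.ext (by simpa [hφf] using hxy))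
  exact congrArg Subtype.val this

theorem IsMor.exists_image (hf : F.IsMor Q f) : ∃ R : Subgroup S, (R : Set S) = f '' Q := by
  obtain ⟨φ, hφ, hφf⟩ := hf
  refine ⟨homImage φ, ?_⟩
  ext y
  simp [homImage, hφf]

theorem IsMor.card_image (hf : F.IsMor Q f) (hR : (R : Set S) = f '' Q) :
    Nat.card R = Nat.card Q := by
  have h : Nat.card (f '' (Q : Set S)) = Nat.card Q := Nat.card_image_of_injOn hf.injOn
  rw [← h, ← hR]; rfl

theorem IsMor.comp (hg : F.IsMor R g) (hf : F.IsMor Q f) (h : ∀ x ∈ Q, f x ∈ R) :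
    F.IsMor Q (g ∘ f) := by
  obtain ⟨φ, hφ, hφf⟩ := hf.exists_hom h
  obtain ⟨ψ, hψ, hψg⟩ := hg
  exact ⟨ψ.comp φ, F.comp_mem hφ hψ, fun x => by simp [hφf, hψg]⟩

theorem IsMor.exists_inverse (hf : F.IsMor Q f) (hR : (R : Set S) = f '' Q) :
    ∃ g, F.IsMor R g ∧ (∀ x ∈ Q, g (f x) = x) ∧ (Q : Set S) = g '' R := by
  have hfR : ∀ x ∈ Q, f x ∈ R := fun x hx => by
    rw [← SetLike.mem_coe, hR]; exact ⟨x, hx, rfl⟩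
  obtain ⟨φ, hφ, hφf⟩ := hf.exists_hom hfR
  have hbij : Function.Bijective φ := by
    refine ⟨F.injective hφ, fun y => ?_⟩
    have hy : (y : S) ∈ f '' Q := hR ▸ y.2
    obtain ⟨x, hx, hxy⟩ := hy
    exact ⟨⟨x, hx⟩, Subtype.ext (by rw [hφf, hxy])⟩
  have hinv := (F.iso_mem (MulEquiv.ofBijective φ hbij) hφ fun _ => rfl).2
  obtain ⟨g, hg, hgφ⟩ := exists_isMor_of_hom hinv
  have hgf : ∀ x ∈ Q, g (f x) = x := by
    intro x hx
    have h := hgφ (MulEquiv.ofBijective φ hbij ⟨x, hx⟩)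
    have h' : (MulEquiv.ofBijective φ hbij).symm.toMonoidHom
        (MulEquiv.ofBijective φ hbij ⟨x, hx⟩) = ⟨x, hx⟩ := MulEquiv.symm_apply_apply _ _
    rw [h'] at h
    exact (congrArg g (hφf ⟨x, hx⟩).symm).trans h
  refine ⟨g, hg, hgf, ?_⟩
  rw [hR]
  ext x
  constructor
  · intro hx
    exact ⟨f x, ⟨x, hx, rfl⟩, hgf x hx⟩
  · rintro ⟨_, ⟨y, hy, rfl⟩, rfl⟩
    rwa [hgf y hy]

theorem IsMor.isConj (hf : F.IsMor Q f) (hR : (R : Set S) = f '' Q) : F.IsConj Q R := by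
  obtain ⟨φ, hφ, hφf⟩ := hf.exists_hom (R := R) fun x hx => by
    rw [← SetLike.mem_coe, hR]; exact ⟨x, hx, rfl⟩
  refine ⟨φ, hφ, SetLike.coe_injective ?_⟩
  rw [hR]
  ext y
  simp [homImage, hφf]

theorem IsConj.exists_isMor (h : F.IsConj Q R) :
    ∃ f, F.IsMor Q f ∧ (R : Set S) = f '' Q := by
  obtain ⟨φ, hφ, hR⟩ := h
  obtain ⟨f, hf, hfφ⟩ := exists_isMor_of_hom hφ
  refine ⟨f, hf, ?_⟩
  rw [← hR]
  ext y
  constructor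
  · rintro ⟨x, rfl⟩
    exact ⟨x, x.2, hfφ x⟩
  · rintro ⟨x, hx, rfl⟩
    exact ⟨⟨x, hx⟩, (hfφ ⟨x, hx⟩).symm⟩

theorem IsConj.trans (h : F.IsConj Q R) (h' : F.IsConj R T) : F.IsConj Q T := by
  obtain ⟨f, hf, hR⟩ := h.exists_isMor
  obtain ⟨g, hg, hT⟩ := h'.exists_isMor
  refine (hg.comp hf fun x hx => ?_).isConj ?_
  · rw [← SetLike.mem_coe, hR]; exact ⟨x, hx, rfl⟩
  · rw [hT, hR, Set.image_image]; rfl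

theorem exists_isFullyNormalized [Finite S] (F : FusionSystem S) (Q : Subgroup S) :
    ∃ R, F.IsConj Q R ∧ F.IsFullyNormalized R := by
  have hne : {R | F.IsConj Q R}.Nonempty :=
    ⟨Q, (F.isMor_conj Q 1).isConj (by simp)⟩
  obtain ⟨R, hR, hmax⟩ := Set.exists_max_image {R | F.IsConj Q R}
    (fun R => Nat.card (Subgroup.normalizer (R : Set S))) (Set.toFinite _) hne
  exact ⟨R, hR, fun T hT => hmax T (IsConj.trans hR hT)⟩

/-- The extension axiom, restricted from N_f to a subgroup `N` of it. -/
theorem IsSaturated.exists_extension {p : ℕ} (hF : F.IsSaturated p) (hf : F.IsMor Q f)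
    (hR : (R : Set S) = f '' Q) (hfn : F.IsFullyNormalized R) {N : Subgroup S}
    (hN : N ≤ Subgroup.normalizer (Q : Set S))
    (hcontrol : ∀ x ∈ N, ∃ y ∈ Subgroup.normalizer (R : Set S),
      ∀ u ∈ Q, f (x * u * x⁻¹) = y * f u * y⁻¹) :
    ∃ g, F.IsMor N g ∧ (Q ≤ N → ∀ x ∈ Q, g x = f x) := by
  obtain ⟨φ, hφ, hφf⟩ := hf
  have him : homImage φ = R := by
    apply SetLike.coe_injective
    rw [hR]
    ext y
    simp [homImage, hφf]
  obtain ⟨ψ, hψ, hext⟩ := hF.extend Q φ hφ (him ▸ hfn)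
  have hle : N ≤ extensionControl φ := by
    intro x hx
    obtain ⟨y, hy, hxy⟩ := hcontrol x hx
    refine ⟨hN hx, y, by rwa [him], fun u v h => ?_⟩
    rw [hφf, hφf, h]
    exact hxy u u.2
  obtain ⟨g, hg, hgψ⟩ := exists_isMor_of_hom hψ
  refine ⟨g, hg.mono hle, fun hQN x hx => ?_⟩
  rw [← hφf ⟨x, hx⟩, ← hext ⟨x, hx⟩ ⟨x, hle (hQN hx)⟩ rfl, ← hgψ]

theorem IsMor.exists_aut (hf : F.IsMor Q f) (h : (Q : Set S) = f '' Q) :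
    ∃ α ∈ F.aut Q, ∀ x : Q, (α x : S) = f x := by
  obtain ⟨φ, hφ, hφf⟩ := hf.exists_hom (R := Q) fun x hx => by
    rw [← SetLike.mem_coe, h]; exact ⟨x, hx, rfl⟩
  have hbij : Function.Bijective φ := by
    refine ⟨F.injective hφ, fun y => ?_⟩
    have hy : (y : S) ∈ f '' Q := h ▸ y.2
    obtain ⟨x, hx, hxy⟩ := hy
    exact ⟨⟨x, hx⟩, Subtype.ext (by rw [hφf, hxy])⟩
  exact ⟨MulEquiv.ofBijective φ hbij, hφ, hφf⟩

theorem exists_isMor_of_aut {α : MulAut Q} (hα : α ∈ F.aut Q) :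
    ∃ f, F.IsMor Q f ∧ (Q : Set S) = f '' Q ∧ ∀ x : Q, f x = α x := by
  obtain ⟨f, hf, hfα⟩ := exists_isMor_of_hom hα
  refine ⟨f, hf, ?_, hfα⟩
  ext y
  constructor
  · intro hy
    refine ⟨α.symm ⟨y, hy⟩, (α.symm ⟨y, hy⟩).2, ?_⟩
    rw [hfα]; simp
  · rintro ⟨x, hx, rfl⟩
    rw [show f x = α ⟨x, hx⟩ from hfα ⟨x, hx⟩]
    exact (α ⟨x, hx⟩).2

theorem conjAut_le_aut (F : FusionSystem S) (Q : Subgroup S) : conjAut Q ≤ F.aut Q := by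
  rintro α ⟨g, -, hg⟩
  exact F.conj_mem g _ hg

theorem exists_conjAut {a : S} (ha : a ∈ Subgroup.normalizer (Q : Set S)) :
    ∃ α ∈ conjAut Q, ∀ x : Q, (α x : S) = a * x * a⁻¹ :=
  ⟨Subgroup.normalizerMonoidHom Q ⟨a, ha⟩, ⟨a, ha, fun _ => rfl⟩, fun _ => rfl⟩

theorem isPGroup_conjAut {p : ℕ} (hS : IsPGroup p S) (Q : Subgroup S) :
    IsPGroup p (conjAut Q) := by
  have h : conjAut Q ≤ (Subgroup.normalizerMonoidHom Q).range := by
    rintro α ⟨a, ha, hα⟩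
    exact ⟨⟨a, ha⟩, MulEquiv.ext fun x => Subtype.ext (hα x).symm⟩
  exact ((hS.to_subgroup _).of_surjective _
    (Subgroup.normalizerMonoidHom Q).rangeRestrict_surjective).to_le h

theorem IsConj.exists_mulEquiv (h : F.IsConj Q R) :
    ∃ e : Q ≃* R, e.toMonoidHom ∈ F.Hom Q R ∧ e.symm.toMonoidHom ∈ F.Hom R Q := by
  obtain ⟨φ, hφ, hR⟩ := h
  have hbij : Function.Bijective φ := by
    refine ⟨F.injective hφ, fun y => ?_⟩
    obtain ⟨x, hx⟩ : (y : S) ∈ homImage φ := hR.symm ▸ y.2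
    exact ⟨x, Subtype.ext hx⟩
  exact ⟨MulEquiv.ofBijective φ hbij, F.iso_mem _ hφ fun _ => rfl⟩

/-! ### Fully normalized subgroups have Sylow `Aut_S(Q)` -/

/-- Move `ψ` to a fully normalized conjugate `R` of `N`. By Sylow's theorem it may be taken there to
be conjugation by some `y`. Since `ψ` preserves `Q`, `y` normalizes the image of `Q`, and maximality
of |N_S(Q)| puts `y` into `R`. -/
theorem exists_normalizer_conj_of_pow_eq_one {p : ℕ} [Fact p.Prime] [Finite S]
    (hfn : F.IsFullyNormalized Q) {N : Subgroup S} (hN : N = Subgroup.normalizer (Q : Set S))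
    (hT : ∀ R, F.IsConj N R → F.IsFullyNormalized R →
      ∃ T : Sylow p (F.aut R), (T : Subgroup (F.aut R)) = (conjAut R).subgroupOf (F.aut R))
    {ψ : MulAut N} (hψ : ψ ∈ F.aut N)
    (hQ : ∀ x : N, (x : S) ∈ Q → (ψ x : S) ∈ Q)
    {a : ℕ} (ha : ψ ^ p ^ a = 1) :
    ∃ z, ∀ x, ψ x = z * x * z⁻¹ := by
  have hQN : Q ≤ N := hN ▸ Subgroup.le_normalizer
  obtain ⟨R, hNR, hR⟩ := F.exists_isFullyNormalized N
  obtain ⟨T, hTR⟩ := hT R hNR hR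
  obtain ⟨e, he, he'⟩ := hNR.exists_mulEquiv
  have hχ : MulAut.congr e ψ ∈ F.aut R := F.comp_mem he' (F.comp_mem hψ he)
  have hχp : IsPGroup p (Subgroup.zpowers (⟨_, hχ⟩ : F.aut R)) := by
    refine IsPGroup.of_card_dvd_pow (n := a) ?_
    rw [Nat.card_zpowers]
    refine orderOf_dvd_of_pow_eq_one (Subtype.ext ?_)
    change (MulAut.congr e ψ) ^ p ^ a = 1
    rw [← map_pow, ha, map_one]
  obtain ⟨U, hU⟩ := hχp.exists_le_sylow
  obtain ⟨γ, hγ⟩ := MulAction.exists_smul_eq (F.aut R) U T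
  have hmem : γ * ⟨_, hχ⟩ * γ⁻¹ ∈ (conjAut R).subgroupOf (F.aut R) := by
    rw [← hTR, ← hγ]
    exact Subgroup.smul_mem_pointwise_smul _ (MulAut.conj γ) _ (hU (Subgroup.mem_zpowers _))
  obtain ⟨y, hy, hyR⟩ := hmem
  let e₁ : N ≃* R := e.trans (γ : MulAut R)
  have he₁ : e₁.toMonoidHom ∈ F.Hom N R := F.comp_mem he γ.2
  have hconj : ∀ x : N, (e₁ (ψ x) : S) = y * e₁ x * y⁻¹ := by
    intro x
    rw [← hyR (e₁ x)]
    simp [e₁, MulAut.congr]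
  obtain ⟨t, ht, hte⟩ := exists_isMor_of_hom he₁
  have hte' : ∀ x : N, t x = e₁ x := hte
  have hRt : (R : Set S) = t '' N := by
    ext v
    constructor
    · intro hv
      refine ⟨e₁.symm ⟨v, hv⟩, (e₁.symm ⟨v, hv⟩).2, ?_⟩
      rw [hte', e₁.apply_symm_apply]
    · rintro ⟨x, hx, rfl⟩
      rw [hte' ⟨x, hx⟩]
      exact (e₁ ⟨x, hx⟩).2
  obtain ⟨Q', hQ'⟩ := (ht.mono hQN).exists_image
  have hRQ' : R ≤ Subgroup.normalizer (Q' : Set S) := by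
    intro r hr
    obtain ⟨x, hx, rfl⟩ : r ∈ t '' N := hRt ▸ hr
    refine Subgroup.mem_normalizer_of_conj_mem fun v hv => ?_
    obtain ⟨u, hu, rfl⟩ : v ∈ t '' Q := hQ' ▸ hv
    rw [← ht.map_conj hx (hQN hu), ← SetLike.mem_coe, hQ']
    exact ⟨_, (Subgroup.mem_normalizer_iff.1 (hN ▸ hx) u).1 hu, rfl⟩
  -- |R| = |N_S(Q)| is the largest order of a normalizer among the conjugates of `Q`, so `R` is all
  -- of N_S(Q').
  have hReq : R = Subgroup.normalizer (Q' : Set S) := by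
    refine Subgroup.eq_of_le_of_card_ge hRQ' ?_
    rw [ht.card_image hRt, hN]
    exact hfn Q' ((ht.mono hQN).isConj hQ')
  have hyR' : y ∈ R := by
    rw [hReq]
    refine Subgroup.mem_normalizer_of_conj_mem fun v hv => ?_
    obtain ⟨u, hu, rfl⟩ : v ∈ t '' Q := hQ' ▸ hv
    have h := hconj ⟨u, hQN hu⟩
    rw [← hte', ← hte'] at h
    rw [← h, ← SetLike.mem_coe, hQ']
    exact ⟨_, hQ _ hu, rfl⟩
  refine ⟨e₁.symm ⟨y, hyR'⟩, fun x => e₁.injective (Subtype.ext ?_)⟩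
  rw [hconj]
  simp

/-- The saturation axioms give this only for S; the rest is by downward induction on |Q|. Otherwise
a `p`-element `φ` outside Aut_S(Q) normalizes it and extends to an automorphism of N_S(Q). A power
of the extension prime to p is inner by the induction hypothesis, which brings `φ` back into
Aut_S(Q). -/
theorem IsSaturated.exists_sylow_eq_conjAut {p : ℕ} [Fact p.Prime] [Finite S]
    (hS : IsPGroup p S) (hF : F.IsSaturated p) (Q : Subgroup S) (hQ : F.IsFullyNormalized Q) :
    ∃ T : Sylow p (F.aut Q), (T : Subgroup (F.aut Q)) = (conjAut Q).subgroupOf (F.aut Q) := by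
  induction hk : Nat.card S - Nat.card Q using Nat.strong_induction_on generalizing Q with
  | _ k ih =>
  subst hk
  rcases eq_or_ne Q ⊤ with rfl | hQtop
  · exact hF.sylow
  have hB : IsPGroup p ((conjAut Q).subgroupOf (F.aut Q)) := (isPGroup_conjAut hS Q).comap_subtype
  obtain ⟨T, hBT⟩ := hB.exists_le_sylow
  by_cases hTB : (T : Subgroup (F.aut Q)) ≤ (conjAut Q).subgroupOf (F.aut Q)
  · exact ⟨T, le_antisymm hTB hBT⟩
  exfalso
  obtain ⟨φ, hφT, hφB, hφN⟩ := T.2.exists_mem_normalizer_notMem hBT hTB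
  apply hφB
  obtain ⟨f, hf, hfQ, hfφ⟩ := exists_isMor_of_aut φ.2
  set N := Subgroup.normalizer (Q : Set S) with hN
  have hQN : Q ≤ N := Subgroup.le_normalizer
  -- As `φ` normalizes Aut_S(Q), its extension control subgroup is all of N_S(Q).
  obtain ⟨g, hg, hgf⟩ := hF.exists_extension (N := N) hf hfQ hQ le_rfl (by
    intro x hx
    obtain ⟨α, hα, hαx⟩ := exists_conjAut hx
    obtain ⟨y, hy, hφy⟩ :=
      (Subgroup.mem_normalizer_iff.1 hφN ⟨α, conjAut_le_aut F Q hα⟩).1 hα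
    refine ⟨y, hy, fun u hu => ?_⟩
    have h := hφy ((φ : MulAut Q) ⟨u, hu⟩)
    rw [show f u = _ from hfφ ⟨u, hu⟩, ← h, ← hαx ⟨u, hu⟩, hfφ]
    simp)
  replace hgf := hgf hQN
  have hgQ : ∀ u ∈ Q, g u ∈ Q := fun u hu => by
    rw [hgf u hu, ← SetLike.mem_coe, hfQ]; exact ⟨u, hu, rfl⟩
  obtain ⟨N', hN'⟩ := hg.exists_image
  have hN'N : N' = N := by
    refine Subgroup.eq_of_le_of_card_ge ?_ (hg.card_image hN').ge
    intro y hy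
    obtain ⟨x, hx, rfl⟩ : y ∈ g '' N := hN' ▸ hy
    refine Subgroup.mem_normalizer_of_conj_mem fun v hv => ?_
    obtain ⟨u, hu, rfl⟩ : v ∈ f '' Q := hfQ ▸ hv
    rw [← hgf u hu, ← hg.map_conj hx (hQN hu)]
    exact hgQ _ ((Subgroup.mem_normalizer_iff.1 hx u).1 hu)
  subst hN'N
  obtain ⟨ψ, hψ, hψg⟩ := hg.exists_aut hN'
  have hψφ : ∀ (n : ℕ) (x : Q), ((ψ ^ n) ⟨x, hQN x.2⟩ : S) = ((φ : MulAut Q) ^ n) x := by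
    intro n x
    exact congrArg Subtype.val (MulAut.map_pow_apply_of_semiconj (α := (φ : MulAut Q))
      (e := Subgroup.inclusion hQN)
      (fun x => Subtype.ext (by rw [hψg]; exact (hgf x x.2).trans (hfφ x))) n x)
  -- The extension `ψ` need not have p-power order, but `ψ ^ m` has; `φ` has p-power order, so it is
  -- recovered from `φ ^ m`.
  obtain ⟨a, m, hm, ham⟩ := Nat.exists_eq_pow_mul_and_not_dvd (orderOf_pos ψ).ne' p
    (Fact.out : p.Prime).ne_one
  obtain ⟨k, hk⟩ := T.2 ⟨φ, hφT⟩
  have hcop : m.Coprime (p ^ k) :=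
    (((Nat.Prime.coprime_iff_not_dvd Fact.out).2 hm).symm).pow_right k
  refine Subgroup.mem_of_pow_mem_of_coprime hcop ?_
    (by rw [show φ ^ p ^ k = 1 from congrArg Subtype.val hk]; exact one_mem _)
  have hz : ∃ z, ∀ x, (ψ ^ m) x = z * x * z⁻¹ := by
    refine exists_normalizer_conj_of_pow_eq_one (p := p) (a := a) hQ hN ?_ (pow_mem hψ m) ?_ ?_
    · intro R hNR hR
      refine ih _ ?_ R hR rfl
      obtain ⟨t, ht, hRt⟩ := hNR.exists_isMor
      rw [ht.card_image hRt]
      obtain ⟨x, -, hxQ, hx⟩ := (hS.to_subgroup ⊤).exists_mem_normalizer_notMem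
        (le_top : Q ≤ ⊤) fun h => hQtop (top_le_iff.1 h)
      have hlt : Nat.card Q < Nat.card N := by
        by_contra hle
        exact hxQ (Subgroup.eq_of_le_of_card_ge hQN (not_lt.1 hle) ▸ hx)
      have := Subgroup.card_le_card_group N
      omega
    · intro x hx
      rw [hψφ m ⟨x, hx⟩]
      exact Subtype.prop _
    · rw [← pow_mul, mul_comm, ← ham, pow_orderOf_eq_one]
  obtain ⟨z, hz⟩ := hz
  refine ⟨z, z.2, fun x => ?_⟩
  have h := congrArg Subtype.val (hz ⟨x, hQN x.2⟩)
  rw [hψφ] at h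
  exact h

/-! ### Strongly closed subgroups and stabilizers of chains -/

theorem IsStronglyClosed.apply_mem (hQ : F.IsStronglyClosed Q) (hf : F.IsMor R f) {x : S}
    (hxR : x ∈ R) (hx : x ∈ Q) : f x ∈ Q := by
  obtain ⟨φ, hφ, hφf⟩ := hf.mono (Subgroup.zpowers_le.2 hxR)
  have h := hQ x hx φ hφ
  rwa [hφf] at h

theorem isStronglyClosed_iff :
    F.IsStronglyClosed Q ↔ ∀ x ∈ Q, ∀ f, F.IsMor (Subgroup.zpowers x) f → f x ∈ Q := by
  refine ⟨fun h x hx f hf => h.apply_mem hf (Subgroup.mem_zpowers x) hx, fun h x hx φ hφ => ?_⟩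
  obtain ⟨f, hf, hfφ⟩ := exists_isMor_of_hom hφ
  rw [← hfφ]
  exact h x hx f hf

theorem isStronglyClosed_top (F : FusionSystem S) : F.IsStronglyClosed ⊤ :=
  fun _ _ _ _ => Subgroup.mem_top _

theorem IsStronglyClosed.normal (hQ : F.IsStronglyClosed Q) : Q.Normal :=
  ⟨fun x hx a => hQ.apply_mem (F.isMor_conj ⊤ a) (Subgroup.mem_top x) hx⟩

theorem IsStronglyClosed.aut_apply_mem (hQ : F.IsStronglyClosed Q) (α : F.aut R) {x : R}
    (hx : (x : S) ∈ Q) : ((α : MulAut R) x : S) ∈ Q := by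
  obtain ⟨f, hf, -, hfα⟩ := exists_isMor_of_aut α.2
  rw [← hfα]
  exact hQ.apply_mem hf x.2 hx

/-- The `F`-automorphisms of `R` that act trivially on all quotients
`(D (i + 1) ⊓ R) / (D i ⊓ R)` of a chain of strongly closed subgroups. -/
def chainStabilizer (F : FusionSystem S) (D : ℕ → Subgroup S)
    (hD : ∀ i, F.IsStronglyClosed (D i)) (R : Subgroup S) : Subgroup (F.aut R) where
  carrier := {α | ∀ i, ∀ u : R, (u : S) ∈ D (i + 1) → (u : S)⁻¹ * (α : MulAut R) u ∈ D i}
  one_mem' := fun i u _ => by simp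
  mul_mem' := by
    intro α β hα hβ i u hu
    have h := (D i).mul_mem (hβ i u hu) (hα i _ ((hD _).aut_apply_mem β hu))
    rwa [mul_assoc, mul_inv_cancel_left] at h
  inv_mem' := by
    intro α hα i u hu
    have h := (D i).inv_mem (hα i _ ((hD _).aut_apply_mem α⁻¹ hu))
    simpa using h

/-- Strong closure makes each `D i ⊓ R` invariant under Aut_F(R). -/
theorem chainStabilizer_normal (D : ℕ → Subgroup S) (hD : ∀ i, F.IsStronglyClosed (D i))
    (R : Subgroup S) : (F.chainStabilizer D hD R).Normal := by
  refine ⟨fun α hα γ i u hu => ?_⟩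
  set v := (γ⁻¹ : MulAut R) u with hv
  have h := (hD i).aut_apply_mem γ (x := v⁻¹ * (α : MulAut R) v)
    (hα i v ((hD _).aut_apply_mem γ⁻¹ hu))
  rw [map_mul, map_inv] at h
  simpa [hv] using h

/-- Climb the chain: if `β` fixes `D i ⊓ R` pointwise and `u` lies in `D (i + 1)`, then `c = u⁻¹
β(u)` is fixed and βⁿ(u) = u cⁿ, so the exponent of S kills the action one step higher. -/
theorem isPGroup_chainStabilizer {p : ℕ} [Finite S] (hS : IsPGroup p S)
    (D : ℕ → Subgroup S) (hD : ∀ i, F.IsStronglyClosed (D i)) (hD0 : D 0 = ⊥) {m : ℕ}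
    (hDm : D m = ⊤) (R : Subgroup S) : IsPGroup p (F.chainStabilizer D hD R) := by
  obtain ⟨e, he⟩ := isPGroup_iff_exists_pow_pow_eq_one.1 hS
  rintro ⟨α, hα⟩
  have key : ∀ i, ∃ k, ∀ u : R, (u : S) ∈ D i → ((α ^ p ^ k : F.aut R) : MulAut R) u = u := by
    intro i
    induction i with
    | zero =>
      refine ⟨0, fun u hu => ?_⟩
      rw [hD0, Subgroup.mem_bot, OneMemClass.coe_eq_one] at hu
      rw [hu, map_one]
    | succ i ih =>
      obtain ⟨k, hk⟩ := ih
      refine ⟨k + e, fun u hu => ?_⟩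
      set β := α ^ p ^ k with hβ
      have hc := hk (u⁻¹ * (β : MulAut R) u) (pow_mem hα _ i u hu)
      have hpow : ∀ n : ℕ, ((β : MulAut R) ^ n) u = u * (u⁻¹ * (β : MulAut R) u) ^ n := by
        intro n
        induction n with
        | zero => simp
        | succ n ihn =>
          rw [pow_succ', MulAut.mul_apply, ihn, map_mul, map_pow, hc, pow_succ', ← mul_assoc,
            mul_inv_cancel_left]
      have h1 : (u⁻¹ * (β : MulAut R) u) ^ p ^ e = 1 := Subtype.ext (he _)
      rw [pow_add, pow_mul, ← hβ, Subgroup.coe_pow, hpow, h1, mul_one]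
  obtain ⟨k, hk⟩ := key m
  refine ⟨k, Subtype.ext (Subtype.ext (MulEquiv.ext fun u => ?_))⟩
  exact hk u (by rw [hDm]; trivial)

/-! ### Normality and extension of morphisms to `QR` -/

/-- The codomain `QT` can be dropped: an extension that maps `Q` onto `Q` and `R` into `T` maps `QR`
into `QT`. -/
theorem isNormal_iff : F.IsNormal Q ↔ Q.Normal ∧ ∀ R f, F.IsMor R f →
    ∃ g, F.IsMor (Q ⊔ R) g ∧ (∀ x ∈ R, g x = f x) ∧ g '' Q = Q := by
  rw [IsNormal, Subgroup.normalizer_eq_top_iff]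
  refine and_congr_right fun hQ => ⟨fun h R f hf => ?_, fun h R T => ?_⟩
  · obtain ⟨φ, hφ, hφf⟩ := hf
    rw [h] at hφ
    obtain ⟨-, ψ, hψ, hψφ, hψQ⟩ := hφ
    obtain ⟨g, hg, hgψ⟩ := exists_isMor_of_hom hψ
    refine ⟨g, hg, fun x hx => ?_, ?_⟩
    · rw [← hφf ⟨x, hx⟩, ← hψφ ⟨x, hx⟩ ⟨x, (le_sup_right : R ≤ Q ⊔ R) hx⟩ rfl, ← hgψ]
    · refine Eq.trans ?_ hψQ
      ext y
      constructor
      · rintro ⟨x, hx, rfl⟩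
        exact ⟨⟨x, (le_sup_left : Q ≤ Q ⊔ R) hx⟩, hx, (hgψ _).symm⟩
      · rintro ⟨x, hx, rfl⟩
        exact ⟨x, hx, hgψ x⟩
  · refine Set.Subset.antisymm (fun φ hφ => ⟨hφ, ?_⟩) fun φ hφ => hφ.1
    obtain ⟨f, hf, hfφ⟩ := exists_isMor_of_hom hφ
    obtain ⟨g, hg, hgf, hgQ⟩ := h R f hf
    obtain ⟨ψ, hψ, hψg⟩ := hg.exists_hom (R := Q ⊔ T) fun x hx => by
      obtain ⟨q, hq, r, hr, rfl⟩ := Subgroup.mem_sup_of_normal_left.1 hx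
      have hr' := (le_sup_right : R ≤ Q ⊔ R) hr
      rw [hg.map_mul ((le_sup_left : Q ≤ Q ⊔ R) hq) hr', hgf r hr, hfφ ⟨r, hr⟩]
      refine Subgroup.mul_mem_sup ?_ (φ ⟨r, hr⟩).2
      rw [← SetLike.mem_coe, ← hgQ]
      exact ⟨q, hq, rfl⟩
    refine ⟨ψ, hψ, fun x y hxy => ?_, ?_⟩
    · rw [hψg, hxy, hgf x x.2, hfφ]
    · refine Eq.trans ?_ hgQ
      ext y
      constructor
      · rintro ⟨x, hx, rfl⟩
        exact ⟨x, hx, (hψg x).symm⟩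
      · rintro ⟨x, hx, rfl⟩
        exact ⟨⟨x, (le_sup_left : Q ≤ Q ⊔ R) hx⟩, hx, hψg _⟩

variable [Finite S] {p : ℕ} [Fact p.Prime]

theorem IsStronglyClosed.image_eq (hQ : F.IsStronglyClosed Q) (hf : F.IsMor R f) (h : Q ≤ R) :
    f '' Q = Q := by
  obtain ⟨Q', hQ'⟩ := (hf.mono h).exists_image
  rw [← hQ', SetLike.coe_set_eq]
  refine Subgroup.eq_of_le_of_card_ge ?_ ((hf.mono h).card_image hQ').ge
  intro y hy
  obtain ⟨x, hx, rfl⟩ : y ∈ f '' Q := hQ' ▸ SetLike.mem_coe.2 hy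
  exact hQ.apply_mem hf (h hx) hx

theorem IsStronglyClosed.coe_sup_eq_image (hQ : F.IsStronglyClosed Q) (hf : F.IsMor (Q ⊔ R) f)
    (hT : (T : Set S) = f '' R) : ((Q ⊔ T : Subgroup S) : Set S) = f '' (Q ⊔ R : Subgroup S) := by
  have := hQ.normal
  ext y
  constructor
  · intro hy
    obtain ⟨q, hq, t, ht, rfl⟩ := Subgroup.mem_sup_of_normal_left.1 hy
    rw [← SetLike.mem_coe, ← hQ.image_eq hf le_sup_left] at hq
    rw [← SetLike.mem_coe, hT] at ht
    obtain ⟨q, hq, rfl⟩ := hq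
    obtain ⟨r, hr, rfl⟩ := ht
    have hq' := (le_sup_left : Q ≤ Q ⊔ R) hq
    have hr' := (le_sup_right : R ≤ Q ⊔ R) hr
    exact ⟨q * r, mul_mem hq' hr', hf.map_mul hq' hr'⟩
  · rintro ⟨x, hx, rfl⟩
    obtain ⟨q, hq, r, hr, rfl⟩ := Subgroup.mem_sup_of_normal_left.1 hx
    have hq' := (le_sup_left : Q ≤ Q ⊔ R) hq
    rw [hf.map_mul hq' ((le_sup_right : R ≤ Q ⊔ R) hr)]
    refine Subgroup.mul_mem_sup (hQ.apply_mem hf hq' hq) ?_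
    rw [← SetLike.mem_coe, hT]
    exact ⟨r, hr, rfl⟩

/-- A morphism of a saturated fusion system with fully normalized image extends to `R N_Q(R)`. -/
theorem IsSaturated.exists_extension_sup_normalizer (hS : IsPGroup p S) (hF : F.IsSaturated p)
    (D : ℕ → Subgroup S) (hD : ∀ i, F.IsStronglyClosed (D i)) (hD0 : D 0 = ⊥) {m : ℕ}
    (hDm : D m = ⊤) (hDQ : ∀ i, ∀ u ∈ D (i + 1), ∀ x ∈ Q, u⁻¹ * (x * u * x⁻¹) ∈ D i)
    (hf : F.IsMor R f) (hT : (T : Set S) = f '' R) (hfn : F.IsFullyNormalized T) :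
    ∃ g, F.IsMor (R ⊔ Subgroup.normalizer (R : Set S) ⊓ Q) g ∧ ∀ x ∈ R, g x = f x := by
  obtain ⟨U, hU⟩ := hF.exists_sylow_eq_conjAut hS T hfn
  have := F.chainStabilizer_normal D hD T
  have hle := (isPGroup_chainStabilizer hS D hD hD0 hDm T).le_sylow_of_normal U
  obtain ⟨g₀, hg₀, hg₀f, hRg₀⟩ := hf.exists_inverse hT
  -- This is N_f, written for the function `f`; being a subgroup, it can be tested on `R` and N_Q(R)
  -- separately.
  let N : Subgroup S :=
    { carrier := {x | x ∈ Subgroup.normalizer (R : Set S) ∧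
        ∃ y ∈ Subgroup.normalizer (T : Set S), ∀ u ∈ R, f (x * u * x⁻¹) = y * f u * y⁻¹}
      one_mem' := ⟨one_mem _, 1, one_mem _, by simp⟩
      mul_mem' := by
        rintro a b ⟨ha, y, hy, hay⟩ ⟨hb, z, hz, hbz⟩
        refine ⟨mul_mem ha hb, y * z, mul_mem hy hz, fun u hu => ?_⟩
        rw [show a * b * u * (a * b)⁻¹ = a * (b * u * b⁻¹) * a⁻¹ by group,
          hay _ ((Subgroup.mem_normalizer_iff.1 hb u).1 hu), hbz u hu]
        group
      inv_mem' := by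
        rintro a ⟨ha, y, hy, hay⟩
        refine ⟨inv_mem ha, y⁻¹, inv_mem hy, fun u hu => ?_⟩
        have h := hay _ ((Subgroup.mem_normalizer_iff.1 (inv_mem ha) u).1 hu)
        rw [show a * (a⁻¹ * u * a⁻¹⁻¹) * a⁻¹ = u by group] at h
        rw [h]
        group }
  have hfT : ∀ u ∈ R, f u ∈ T := fun u hu => by
    rw [← SetLike.mem_coe, hT]; exact ⟨u, hu, rfl⟩
  have hN : R ⊔ Subgroup.normalizer (R : Set S) ⊓ Q ≤ N := by
    refine sup_le (fun x hx => ?_) fun x hx => ?_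
    · exact ⟨Subgroup.le_normalizer hx, f x, Subgroup.le_normalizer (hfT x hx),
        fun u hu => hf.map_conj hx hu⟩
    · obtain ⟨hxR, hxQ⟩ := hx
      have hconj : ∀ u ∈ R, x * u * x⁻¹ ∈ R := fun u =>
        (Subgroup.mem_normalizer_iff.1 hxR u).1
      have hg₀R : ∀ v ∈ T, g₀ v ∈ R := fun v hv => by
        rw [← SetLike.mem_coe, hRg₀]; exact ⟨v, hv, rfl⟩
      have hfg₀ : ∀ v ∈ T, f (g₀ v) = v := fun v hv => by
        obtain ⟨u, hu, rfl⟩ : v ∈ f '' R := hT ▸ hv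
        rw [hg₀f u hu]
      -- Conjugation by `x ∈ Q`, carried over to `T`. It stabilizes the chain because `Q` does and
      -- `f`, `g₀` respect every `D i`.
      have h1 : F.IsMor T (f ∘ (fun u => x * u * x⁻¹) ∘ g₀) :=
        hf.comp ((F.isMor_conj R x).comp hg₀ hg₀R) fun v hv => hconj _ (hg₀R v hv)
      obtain ⟨T', hT'⟩ := h1.exists_image
      have hT'T : T' = T := by
        refine Subgroup.eq_of_le_of_card_ge ?_ (h1.card_image hT').ge
        intro y hy
        obtain ⟨v, hv, rfl⟩ : y ∈ (f ∘ (fun u => x * u * x⁻¹) ∘ g₀) '' T :=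
          hT' ▸ SetLike.mem_coe.2 hy
        exact hfT _ (hconj _ (hg₀R v hv))
      obtain ⟨α, hα, hαf⟩ := h1.exists_aut (hT'T ▸ hT')
      have hmem : (⟨α, hα⟩ : F.aut T) ∈ F.chainStabilizer D hD T := by
        intro i v hv
        have hu := (hD _).apply_mem hg₀ v.2 hv
        have huR := hg₀R v v.2
        have h2 := (hD i).apply_mem hf (R.mul_mem (R.inv_mem huR) (hconj _ huR))
          (hDQ i _ hu x hxQ)
        rw [hf.map_mul (R.inv_mem huR) (hconj _ huR), hf.map_inv huR, hfg₀ v v.2] at h2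
        change (v : S)⁻¹ * (α v : S) ∈ D i
        rw [hαf]
        exact h2
      have hU' := hle hmem
      rw [hU] at hU'
      obtain ⟨y, hy, hyα⟩ := hU'
      refine ⟨hxR, y, hy, fun u hu => ?_⟩
      have h3 : (α ⟨f u, hfT u hu⟩ : S) = y * f u * y⁻¹ := hyα ⟨f u, hfT u hu⟩
      rw [← h3, hαf]
      simp [hg₀f u hu]
  obtain ⟨g, hg, hgf⟩ := hF.exists_extension hf hT hfn (fun x hx => (hN hx).1)
    (fun x hx => (hN hx).2)
  exact ⟨g, hg, hgf le_sup_left⟩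

/-- Downward induction on |R|. When the image is not fully normalized, `f` is factored through a
fully normalized conjugate `T`: both `R` → `T` and f(R) → `T` extend, and the first extension is
followed by the inverse of the second. -/
theorem IsSaturated.exists_extension_sup (hS : IsPGroup p S) (hF : F.IsSaturated p)
    (hQ : F.IsStronglyClosed Q)
    (D : ℕ → Subgroup S) (hD : ∀ i, F.IsStronglyClosed (D i)) (hD0 : D 0 = ⊥) {m : ℕ}
    (hDm : D m = ⊤) (hDQ : ∀ i, ∀ u ∈ D (i + 1), ∀ x ∈ Q, u⁻¹ * (x * u * x⁻¹) ∈ D i)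
    (hf : F.IsMor R f) :
    ∃ g, F.IsMor (Q ⊔ R) g ∧ ∀ x ∈ R, g x = f x := by
  induction hk : Nat.card S - Nat.card R using Nat.strong_induction_on generalizing R f with
  | _ k ih =>
  subst hk
  have := hQ.normal
  by_cases hQR : Q ≤ R
  · rw [sup_eq_right.2 hQR]
    exact ⟨f, hf, fun _ _ => rfl⟩
  -- Stated for every `R'` of the order of `R`, since it is needed for `R` and for its image under
  -- `f`.
  have key : ∀ (R' T : Subgroup S) (f : S → S), ¬ Q ≤ R' → Nat.card R' = Nat.card R →
      F.IsMor R' f → (T : Set S) = f '' R' → F.IsFullyNormalized T →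
      ∃ g, F.IsMor (Q ⊔ R') g ∧ ∀ x ∈ R', g x = f x := by
    intro R' T f hQR' hcard hf hT hfn
    obtain ⟨g, hg, hgf⟩ := hF.exists_extension_sup_normalizer hS D hD hD0 hDm hDQ hf hT hfn
    obtain ⟨x, hxQR, hxR, hxN⟩ := (hS.to_subgroup (Q ⊔ R')).exists_mem_normalizer_notMem
      (le_sup_right : R' ≤ Q ⊔ R') fun h => hQR' (le_sup_left.trans h)
    set N := R' ⊔ Subgroup.normalizer (R' : Set S) ⊓ Q with hN
    have hlt : Nat.card R' < Nat.card N := by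
      by_contra hle
      have hR'N : R' = N := Subgroup.eq_of_le_of_card_ge le_sup_left (not_lt.1 hle)
      -- Normalizers grow in `QR'`, and the `Q`-factor of the new element already normalizes `R'`.
      obtain ⟨q, hq, r, hr, rfl⟩ := Subgroup.mem_sup_of_normal_left.1 hxQR
      have hqN : q ∈ Subgroup.normalizer (R' : Set S) := by
        have h := mul_mem hxN (inv_mem (Subgroup.le_normalizer hr))
        rwa [mul_inv_cancel_right] at h
      have hqR : q ∈ R' := by
        rw [hR'N]
        exact (le_sup_right : _ ≤ N) ⟨hqN, hq⟩
      exact hxR (mul_mem hqR hr)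
    obtain ⟨h, hh, hhg⟩ := ih _ (by have := Subgroup.card_le_card_group N; omega) hg rfl
    exact ⟨h, hh.mono (sup_le_sup_left le_sup_left _), fun x hx => by
      rw [hhg x ((le_sup_left : R' ≤ N) hx), hgf x hx]⟩
  obtain ⟨T, hRT, hT⟩ := F.exists_isFullyNormalized R
  obtain ⟨a, ha, hTa⟩ := hRT.exists_isMor
  obtain ⟨R', hR'⟩ := hf.exists_image
  obtain ⟨f', hf', hf'f, hRf'⟩ := hf.exists_inverse hR'
  have hb : F.IsMor R' (a ∘ f') := ha.comp hf' fun x hx => by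
    rw [← SetLike.mem_coe, hRf']; exact ⟨x, hx, rfl⟩
  have hTb : (T : Set S) = (a ∘ f') '' R' := by rw [Set.image_comp, ← hRf', hTa]
  have hQR' : ¬ Q ≤ R' := fun h => hQR fun x hx => by
    rw [← SetLike.mem_coe, hRf']
    rw [← SetLike.mem_coe, ← hQ.image_eq hf' h] at hx
    exact Set.image_mono h hx
  obtain ⟨A, hA, hAa⟩ := key R T a hQR rfl ha hTa hT
  obtain ⟨B, hB, hBb⟩ := key R' T _ hQR' (hf.card_image hR') hb hTb hT
  obtain ⟨C, hC, hCB, -⟩ := hB.exists_inverse (R := Q ⊔ T)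
    (hQ.coe_sup_eq_image hB (by rw [hTb]; exact Set.image_congr fun x hx => (hBb x hx).symm))
  refine ⟨C ∘ A, hC.comp hA fun x hx => ?_, fun x hx => ?_⟩
  · rw [← SetLike.mem_coe, hQ.coe_sup_eq_image hA
      (by rw [hTa]; exact Set.image_congr fun x hx => (hAa x hx).symm)]
    exact ⟨x, hx, rfl⟩
  · have hfx : f x ∈ R' := by
      rw [← SetLike.mem_coe, hR']; exact ⟨x, hx, rfl⟩
    have h := hCB (f x) ((le_sup_right : R' ≤ Q ⊔ R') hfx)
    rw [hBb _ hfx] at h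
    simp only [Function.comp_apply, hf'f x hx] at h ⊢
    rw [hAa x hx, h]

theorem IsSaturated.isNormal_of_chain (hS : IsPGroup p S)
    (hF : F.IsSaturated p) (hQ : F.IsStronglyClosed Q)
    (D : ℕ → Subgroup S) (hD : ∀ i, F.IsStronglyClosed (D i)) (hD0 : D 0 = ⊥) {m : ℕ}
    (hDm : D m = ⊤) (hDQ : ∀ i, ∀ u ∈ D (i + 1), ∀ x ∈ Q, u⁻¹ * (x * u * x⁻¹) ∈ D i) :
    F.IsNormal Q := by
  refine isNormal_iff.2 ⟨hQ.normal, fun R f hf => ?_⟩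
  obtain ⟨g, hg, hgf⟩ := hF.exists_extension_sup hS hQ D hD hD0 hDm hDQ hf
  exact ⟨g, hg, hgf, hQ.image_eq hg le_sup_left⟩

/-- If the terms of the upper central series of `Q` are strongly closed in a saturated fusion
system, then `Q` is normal in that system. -/
theorem IsSaturated.isNormal_of_upperCentralSeries (hS : IsPGroup p S) (hF : F.IsSaturated p)
    (hQ : ∀ n, F.IsStronglyClosed ((Subgroup.upperCentralSeries Q n).map Q.subtype)) :
    F.IsNormal Q := by
  have := (hS.to_subgroup Q).isNilpotent
  obtain ⟨n, hn⟩ := Group.IsNilpotent.nilpotent Q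
  have hnQ : (Subgroup.upperCentralSeries Q n).map Q.subtype = Q := by
    rw [hn, ← MonoidHom.range_eq_map, Subgroup.range_subtype]
  have hQc : F.IsStronglyClosed Q := hnQ ▸ hQ n
  have := hQc.normal
  refine hF.isNormal_of_chain hS hQc
    -- The chain reaches `Q` at index `n`; one more step, from `Q` to S, is covered by normality of
    -- `Q`.
    (fun i => if i ≤ n then (Subgroup.upperCentralSeries Q i).map Q.subtype else ⊤)
    (fun i => ?_) (by simp) (m := n + 1) (by simp) fun i u hu x hx => ?_
  · split_ifs
    exacts [hQ i, F.isStronglyClosed_top]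
  · split_ifs with hi
    · split_ifs at hu with hi'
      · obtain ⟨u, hu, rfl⟩ := hu
        refine ⟨u⁻¹ * (⟨x, hx⟩ * u * ⟨x, hx⟩⁻¹), ?_, rfl⟩
        -- Applied to `u⁻¹`, because the required element is the commutator ⁅u⁻¹, x⁆.
        have h := Subgroup.mem_upperCentralSeries_succ_iff.1 (inv_mem hu) ⟨x, hx⟩
        rwa [commutatorElement_def, inv_inv, mul_assoc, mul_assoc, ← mul_assoc _ u] at h
      · obtain rfl : i = n := by omega
        rw [hnQ, ← mul_assoc]
        refine mul_mem ?_ (inv_mem hx)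
        have h := this.conj_mem x hx u⁻¹
        rwa [inv_inv, mul_assoc] at h
    · trivial

end

/-! ### Comparison of a fusion system with its restriction -/

section restrict

variable {S : Type u} [Group S] {P : Type v} [Group P] {F : FusionSystem S} {i : P →* S}
  {hi : Function.Injective i} {Q : Subgroup P}

theorem isMor_restrict_iff {f : P → P} {f' : S → S} (h : ∀ x ∈ Q, f' (i x) = i (f x)) :
    (F.restrict i hi).IsMor Q f ↔ F.IsMor (Q.map i) f' := by
  constructor
  · rintro ⟨φ, hφ, hφf⟩
    refine isMor_of_hom hφ fun y => ?_
    obtain ⟨x, rfl⟩ := (Q.equivMapOfInjective i hi).surjective y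
    rw [transport_apply, hφf, ← h x x.2]
    rfl
  · intro hf
    obtain ⟨φ, hφ, hφf⟩ := hf.exists_hom (R := (⊤ : Subgroup P).map i) (by
      rintro _ ⟨x, hx, rfl⟩
      exact ⟨f x, Subgroup.mem_top _, (h x hx).symm⟩)
    let φ' : Q →* (⊤ : Subgroup P) :=
      ((Subgroup.equivMapOfInjective ⊤ i hi).symm.toMonoidHom.comp φ).comp
        (Q.equivMapOfInjective i hi).toMonoidHom
    have ht : transport i hi φ' = φ := by
      ext x
      simp [transport, φ']
    refine ⟨φ', ?_, fun x => hi ?_⟩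
    · change transport i hi φ' ∈ F.Hom _ _
      rwa [ht]
    · rw [← transport_apply i hi, ht, hφf, ← h x x.2]
      rfl

/-- Strong closure of P keeps the values of `f` inside P, where `i` can be inverted. -/
theorem exists_isMor_restrict (hP : F.IsStronglyClosed i.range) {f : S → S}
    (hf : F.IsMor (Q.map i) f) :
    ∃ f₀ : P → P, (F.restrict i hi).IsMor Q f₀ ∧ ∀ x ∈ Q, f (i x) = i (f₀ x) := by
  have h : ∀ x ∈ Q, f (i x) = i (Function.invFun i (f (i x))) := fun x hx =>
    (Function.invFun_eq (hP.apply_mem hf (Subgroup.mem_map_of_mem i hx) ⟨x, rfl⟩)).symm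
  exact ⟨fun x => Function.invFun i (f (i x)), (isMor_restrict_iff h).2 hf, h⟩

/-- A morphism on ⟨k⟩ descends to P, and normality of `Q` extends it to one that induces an
automorphism of `Q`; this automorphism preserves `K`. -/
theorem isStronglyClosed_map_of_isNormal_restrict (hP : F.IsStronglyClosed i.range)
    (hQ : (F.restrict i hi).IsNormal Q) (K : Subgroup Q) [hK : K.Characteristic] :
    F.IsStronglyClosed ((K.map Q.subtype).map i) := by
  rw [isStronglyClosed_iff]
  rintro _ ⟨_, ⟨k, hk, rfl⟩, rfl⟩ f hf
  rw [← MonoidHom.map_zpowers] at hf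
  obtain ⟨f₀, hf₀, hff₀⟩ := exists_isMor_restrict (hi := hi) hP hf
  obtain ⟨g, hg, hgf, hgQ⟩ := (isNormal_iff.1 hQ).2 _ f₀ hf₀
  obtain ⟨α, -, hαg⟩ := (hg.mono le_sup_left).exists_aut hgQ.symm
  have hkz : (k : P) ∈ Subgroup.zpowers (k : P) := Subgroup.mem_zpowers _
  refine ⟨f₀ k, ⟨α k, ?_, ?_⟩, (hff₀ k hkz).symm⟩
  · have h := hK.fixed α
    rw [← h] at hk
    exact hk
  · exact (hαg k).trans (hgf k hkz)

theorem isNormal_restrict_of_isNormal (hP : F.IsStronglyClosed i.range)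
    (hQ : F.IsNormal (Q.map i)) : (F.restrict i hi).IsNormal Q := by
  obtain ⟨hQn, hext⟩ := isNormal_iff.1 hQ
  refine isNormal_iff.2 ⟨?_, fun R f hf => ?_⟩
  · rw [← Subgroup.comap_map_eq_self_of_injective hi Q]
    infer_instance
  · have h : ∀ x ∈ R, i (f (Function.invFun i (i x))) = i (f x) := fun x _ => by
      rw [Function.leftInverse_invFun hi x]
    obtain ⟨g, hg, hgf, hgQ⟩ := hext _ (fun y => i (f (Function.invFun i y)))
      ((isMor_restrict_iff (hi := hi) h).1 hf)
    rw [← Subgroup.map_sup] at hg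
    obtain ⟨g₀, hg₀, hgg₀⟩ := exists_isMor_restrict (hi := hi) hP hg
    refine ⟨g₀, hg₀, fun x hx => hi ?_, hi.image_injective ?_⟩
    · rw [← hgg₀ x ((le_sup_right : R ≤ Q ⊔ R) hx), hgf _ (Subgroup.mem_map_of_mem i hx), h x hx]
    · rw [Subgroup.coe_map, Set.image_image] at hgQ
      rw [← hgQ.trans (Subgroup.coe_map i Q), Set.image_image]
      exact Set.image_congr fun x hx => (hgg₀ x ((le_sup_left : Q ≤ Q ⊔ R) hx)).symm

/-- A subgroup of a strongly closed subgroup `P` is normal in the restriction of a saturated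
fusion system to `P` if and only if it is normal in the whole system. -/
theorem IsInducedBy.isNormal_iff {p : ℕ} [Fact p.Prime] [Finite S] (hS : IsPGroup p S)
    {E : FusionSystem P} (hE : E.IsInducedBy p F i hi) (Q : Subgroup P) :
    E.IsNormal Q ↔ F.IsNormal (Q.map i) := by
  obtain ⟨hF, hP, rfl⟩ := hE
  refine ⟨fun hQ => hF.isNormal_of_upperCentralSeries hS fun n => ?_,
    isNormal_restrict_of_isNormal hP⟩
  have h := isStronglyClosed_map_of_isNormal_restrict hP hQ (Subgroup.upperCentralSeries Q n)
  convert h using 1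
  -- The upper central series of `Q.map i` is that of `Q` carried along the isomorphism.
  rw [← Subgroup.comap_upperCentralSeries (Q.equivMapOfInjective i hi).symm,
    Subgroup.comap_equiv_eq_map_symm, MulEquiv.symm_symm, Subgroup.map_map, Subgroup.map_map]
  congr 1

end restrict

end FusionSystem

theorem mainTheorem6 (p : ℕ) [Fact p.Prime] (P : Type u) [Group P] [Finite P]
    (hP : IsPGroup p P) :
    (IsStronglyResistantInSaturated p P ↔ IsResistantInSemisaturated p P) ∧
    ∀ (S : Type u) [Group S] [Finite S], IsPGroup p S →
      ∀ (F : FusionSystem S) (E : FusionSystem P) (i : P →* S) (hi : Function.Injective i),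
        E.IsInducedBy p F i hi →
          ∀ Q : Subgroup P, E.IsNormal Q ↔ F.IsNormal (Q.map i) := by
  refine ⟨⟨fun h E => ?_, fun h S _ _ hS F i hi hF hPc => ?_⟩,
    fun S _ _ hS F E i hi hE Q => hE.isNormal_iff hS Q⟩
  · rintro ⟨S, _, F, i, hi, hfin, hS, hE⟩
    rw [hE.isNormal_iff hS, ← MonoidHom.range_eq_map]
    exact h S hS F i hi hE.saturated hE.stronglyClosed
  · have hE : (F.restrict i hi).IsInducedBy p F i hi := ⟨hF, hPc, rfl⟩
    rw [MonoidHom.range_eq_map, ← hE.isNormal_iff hS]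
    exact h _ ⟨S, _, F, i, hi, inferInstance, hS, hE⟩
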